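/- **Setting.** Let $n,m\ge 1$ and let $\theta=(\theta_i)_{i\in\mathbb Z}$ be a strictly increasing real sequence, unbounded on the left and on the right. Put $\beta(t)=i$ for $\theta_i\le t<\theta_{i+1}$, let $p_1,\dots,p_m\ge 0$ be integers and $p^0=\max_j p_j$. Consider $$x'(t)=A(t)x(t)+f\bigl(t,x(\theta_{\beta(t)-p_1}),\dots,x(\theta_{\beta(t)-p_m})\bigr),\qquad x(t)\in\mathbb R^n .\tag{1}$$ $\|\cdot\|$ is the Euclidean norm, and its operator norm for matrices. A solution on $\mathbb R$ is a continuous function that is differentiable off the points $\theta_i$, has one-sided derivatives at them, and satisfies (1) on each $[\theta_i,\theta_{i+1})$ (with the right derivative at $\theta_i$). A solution with initial moment $\theta_k$ is a continuous function on $[\theta_{k-p^0},\infty)$ that satisfies (1) in the same sense on each $[\theta_i,\theta_{i+1})$, $i\ge k$. A function on $\mathbb R$ is almost periodic if it is bounded, uniformly continuous, and for every $\varepsilon>0$ its $\varepsilon$-translation numbers are relatively dense. $\theta$ is a Wexler sequence if there is a nondecreasing sequence $\gamma=(\gamma_i)_{i\in\mathbb Z}$ that takes exactly the values $\theta_i$,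 each with multiplicity at most some fixed $N$, such that for every $\varepsilon>0$ the set of integers $q$ with $|(\gamma_{i+q+j}-\gamma_{i+q})-(\gamma_{i+j}-\gamma_i)|<\varepsilon$ for all $i,j\in\mathbb Z$ is relatively dense. **Assumptions.** * (C1) $A$ is an almost periodic $n\times n$ matrix function. * (C2) For every $s\ge0$, $f$ is bounded and uniformly continuous on $\mathbb R\times G_s^m$, $G_s=\{\|x\|\le s\}$, and almost periodic in $t$ uniformly in $z\in G_s^m$. * (C3) There is $l>0$ with $\|f(t,z_1)-f(t,z_2)\|\le l\sum_{j=1}^m\|z_1^j-z_2^j\|$ for all $t$, $z_1$, $z_2$. * (C5) $\theta$ is a Wexler sequence. * (C6) With $X$ a fundamental matrix of $x'=A(t)x$ and $X(t,s)=X(t)X^{-1}(s)$, there are $K\ge1$, $\sigma>0$ with $\|X(t,s)\|\le Ke^{-\sigma(t-s)}$ for $t\ge s$. * (C7) $l<\sigma/(mK)$. * (C8) $0<a<\sigma$ and $\zeta(l)=1-e^{a\tau}Klm(\sigma-a)^{-1}>0$, where $\tau=\max_j\sup_t(t-\theta_{\beta(t)-p_j})$. **Theorem (exponential stability).** Assume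 (C1)–(C3) and (C5)–(C8), and let $\xi$ be an almost periodic solution of (1) on $\mathbb R$. Then $\xi$ is the only almost periodic solution of (1), and for every $k\in\mathbb Z$ the following hold. 1. For all vectors $\varphi^0,\dots,\varphi^{p^0}\in\mathbb R^n$ there is a solution $x$ of (1) with initial moment $\theta_k$ and $x(\theta_{k-q})=\varphi^q$, $0\le q\le p^0$, and any two such solutions coincide on $[\theta_k,\infty)$. 2. $\xi$ is exponentially stable with rate $a$: for every $\varepsilon>0$ there is $\delta>0$ such that every solution $x$ of (1) with initial moment $\theta_k$ and $\max_{0\le q\le p^0}\|x(\theta_{k-q})-\xi(\theta_{k-q})\|<\delta$ satisfies $$\|x(t)-\xi(t)\|<\varepsilon\, e^{-a(t-\theta_k)}\qquad\text{for all } t\ge\theta_k .$$ 3. If each of $0,1,\dots,p^0$ occurs among $p_1,\dots,p_m$, then 2 holds with the condition on the initial values replaced by $\max_{1\le j\le m}\|x(\theta_{k-p_j})-\xi(\theta_{k-p_j})\|<\delta$. -/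

import Mathlib

open Set Filter Topology

noncomputable section

/-- `ℝⁿ` with the Euclidean norm. -/
abbrev Vec (n : ℕ) : Type := EuclideanSpace ℝ (Fin n)

/-- A set of reals that meets every interval `[a, a + L]`, for some `L > 0`. -/
def RelativelyDense (S : Set ℝ) : Prop :=
  ∃ L : ℝ, 0 < L ∧ ∀ a : ℝ, (Icc a (a + L) ∩ S).Nonempty

/-- A set of integers that meets every interval `[a, a + L]`, for some `L > 0`. -/
def RelativelyDenseInt (S : Set ℤ) : Prop :=
  ∃ L : ℤ, 0 < L ∧ ∀ a : ℤ, (Icc a (a + L) ∩ S).Nonempty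

/-- Bohr almost periodic functions on `ℝ`: bounded, uniformly continuous, and with a relatively
dense set of `ε`-translation numbers for every `ε > 0`. -/
def IsAlmostPeriodic {F : Type*} [NormedAddCommGroup F] (g : ℝ → F) : Prop :=
  (∃ C : ℝ, ∀ t, ‖g t‖ ≤ C) ∧ UniformContinuous g ∧
    ∀ ε : ℝ, 0 < ε → RelativelyDense {τ : ℝ | ∀ t, ‖g (t + τ) - g t‖ < ε}

/-- The set `G_s^m`, where `G_s` is the closed ball of radius `s` about `0` in `ℝⁿ`. -/
def ballProd (n m : ℕ) (s : ℝ) : Set (Fin m → Vec n) :=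
  {z | ∀ j, ‖z j‖ ≤ s}

/-- Functions on `ℝ × G_s^m` that are almost periodic in `t` uniformly with respect to
`z ∈ G_s^m`. -/
def IsAlmostPeriodicOn {n m : ℕ} (f : ℝ → (Fin m → Vec n) → Vec n) (s : ℝ) : Prop :=
  (∃ C : ℝ, ∀ t, ∀ z ∈ ballProd n m s, ‖f t z‖ ≤ C) ∧
    UniformContinuousOn (fun q : ℝ × (Fin m → Vec n) => f q.1 q.2) (univ ×ˢ ballProd n m s) ∧
    ∀ ε : ℝ, 0 < ε →
      RelativelyDense {τ : ℝ | ∀ t, ∀ z ∈ ballProd n m s, ‖f (t + τ) z - f t z‖ < ε}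

/-- Strictly increasing two-sided sequences, unbounded on the left and on the right. -/
def IsNodeSequence (θ : ℤ → ℝ) : Prop :=
  StrictMono θ ∧ Tendsto θ atTop atTop ∧ Tendsto θ atBot atBot

/-- `γ` lists the points of `θ` in nondecreasing order, each at least once, with bounded
multiplicity. -/
def IsRepresentative (θ γ : ℤ → ℝ) : Prop :=
  Monotone γ ∧ range γ = range θ ∧ ∃ N : ℕ, ∀ i : ℤ, (γ ⁻¹' {θ i}).encard ≤ N

/-- The sequences `γ^j`, `γ^j_i = γ_{i+j} - γ_i`, `j ∈ ℤ`, are equipotentially almost periodic: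
for each `ε > 0` the `ε`-almost periods common to all of them are relatively dense. -/
def IsEquipotentiallyAlmostPeriodic (γ : ℤ → ℝ) : Prop :=
  ∀ ε : ℝ, 0 < ε → RelativelyDenseInt
    {q : ℤ | ∀ i j : ℤ, |(γ (i + q + j) - γ (i + q)) - (γ (i + j) - γ i)| < ε}

/-- Wexler sequences. -/
def IsWexler (θ : ℤ → ℝ) : Prop :=
  IsNodeSequence θ ∧ ∃ γ : ℤ → ℝ, IsRepresentative θ γ ∧ IsEquipotentiallyAlmostPeriodic γ

/-- The identification function: the index `i` with `θ i ≤ t < θ (i + 1)`. -/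
def beta (θ : ℤ → ℝ) (t : ℝ) : ℤ := sSup {i : ℤ | θ i ≤ t}

theorem beta_eq_of_mem {θ : ℤ → ℝ} (hθ : StrictMono θ) {i : ℤ} {t : ℝ}
    (h : t ∈ Ico (θ i) (θ (i + 1))) : beta θ t = i := by
  refine IsGreatest.csSup_eq ⟨h.1, fun k hk => ?_⟩
  have h1 : θ k < θ (i + 1) := lt_of_le_of_lt hk h.2
  have h2 : k < i + 1 := hθ.lt_iff_lt.mp h1
  omega

/-- The right-hand side `A(t) x(t) + f(t, x(θ_{β(t) - p_1}), …, x(θ_{β(t) - p_m}))`. -/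
def rhs {n m : ℕ} (A : ℝ → (Vec n →L[ℝ] Vec n)) (f : ℝ → (Fin m → Vec n) → Vec n)
    (θ : ℤ → ℝ) (p : Fin m → ℕ) (x : ℝ → Vec n) (t : ℝ) : Vec n :=
  A t (x t) + f t (fun j => x (θ (beta θ t - (p j : ℤ))))

/-- Solutions on `ℝ`: `x` is continuous, the derivative exists off the nodes, one-sided
derivatives exist at the nodes, and the equation holds on each `[θ_i, θ_{i+1})`, with the right
derivative at `θ_i`. -/
def IsSolution {n m : ℕ} (A : ℝ → (Vec n →L[ℝ] Vec n)) (f : ℝ → (Fin m → Vec n) → Vec n)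
    (θ : ℤ → ℝ) (p : Fin m → ℕ) (x : ℝ → Vec n) : Prop :=
  Continuous x ∧
    (∀ t : ℝ, t ∉ range θ → HasDerivAt x (rhs A f θ p x t) t) ∧
    ∀ i : ℤ, HasDerivWithinAt x (rhs A f θ p x (θ i)) (Ici (θ i)) (θ i) ∧
      ∃ d : Vec n, HasDerivWithinAt x d (Iic (θ i)) (θ i)

/-- The largest delay `p⁰ = max_j p_j`. -/
def maxDelay {m : ℕ} (p : Fin m → ℕ) : ℕ := Finset.univ.sup p

/-- Solutions of the initial value problem with initial moment `θ_k`: `x` is continuous on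
`[θ_{k - p⁰}, ∞)` and satisfies the equation on each `[θ_i, θ_{i+1})`, `i ≥ k`. The values of `x`
to the left of `θ_{k - p⁰}` play no role. -/
def IsSolutionFrom {n m : ℕ} (A : ℝ → (Vec n →L[ℝ] Vec n))
    (f : ℝ → (Fin m → Vec n) → Vec n) (θ : ℤ → ℝ) (p : Fin m → ℕ) (k : ℤ)
    (x : ℝ → Vec n) : Prop :=
  ContinuousOn x (Ici (θ (k - (maxDelay p : ℤ)))) ∧
    (∀ t : ℝ, θ k < t → t ∉ range θ → HasDerivAt x (rhs A f θ p x t) t) ∧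
    (∀ i : ℤ, k ≤ i → HasDerivWithinAt x (rhs A f θ p x (θ i)) (Ici (θ i)) (θ i)) ∧
    ∀ i : ℤ, k < i → ∃ d : Vec n, HasDerivWithinAt x d (Iic (θ i)) (θ i)

/-- `X` is a fundamental matrix of `x' = A(t) x`. -/
def IsFundamentalMatrix {n : ℕ} (A : ℝ → (Vec n →L[ℝ] Vec n))
    (X : ℝ → (Vec n →L[ℝ] Vec n)ˣ) : Prop :=
  ∀ t : ℝ, HasDerivAt (fun s => (X s : Vec n →L[ℝ] Vec n)) (A t * (X t : Vec n →L[ℝ] Vec n)) t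

/-- The Cauchy matrix `X(t, s) = X(t) X⁻¹(s)`. -/
def cauchyMatrix {n : ℕ} (X : ℝ → (Vec n →L[ℝ] Vec n)ˣ) (t s : ℝ) : Vec n →L[ℝ] Vec n :=
  ((X t * (X s)⁻¹ : (Vec n →L[ℝ] Vec n)ˣ) : Vec n →L[ℝ] Vec n)

/-- `τ = max_j sup_t (t - θ_{β(t) - p_j})`. -/
def delaySup {m : ℕ} (θ : ℤ → ℝ) (p : Fin m → ℕ) : ℝ :=
  sSup {r : ℝ | ∃ (t : ℝ) (j : Fin m), r = t - θ (beta θ t - (p j : ℤ))}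

/-- `ζ(l) = 1 - exp(a τ) K l m (σ - a)⁻¹`. -/
def zeta {m : ℕ} (θ : ℤ → ℝ) (p : Fin m → ℕ) (K σ a l : ℝ) : ℝ :=
  1 - Real.exp (a * delaySup θ p) * K * l * m * (σ - a)⁻¹

/-- Exponential stability of the solution `ξ` with rate `a`, for initial moment `θ_k` and initial
values measured at the points `θ_{k - q}`, `q ∈ S`. -/
def IsExponentiallyStable {n m : ℕ} (A : ℝ → (Vec n →L[ℝ] Vec n))
    (f : ℝ → (Fin m → Vec n) → Vec n) (θ : ℤ → ℝ) (p : Fin m → ℕ) (S : Set ℕ) (k : ℤ) (a : ℝ)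
    (ξ : ℝ → Vec n) : Prop :=
  0 < a ∧ ∀ ε : ℝ, 0 < ε → ∃ δ : ℝ, 0 < δ ∧
    ∀ x : ℝ → Vec n, IsSolutionFrom A f θ p k x →
      (∀ q ∈ S, ‖x (θ (k - (q : ℤ))) - ξ (θ (k - (q : ℤ)))‖ < δ) →
      ∀ t : ℝ, θ k ≤ t → ‖x t - ξ t‖ < ε * Real.exp (-a * (t - θ k))

end

/-!
The theorem rests on one estimate, `IsSolutionFrom.norm_sub_le`: if `x` and `y` are solutions with
initial moment `θ_k` whose values at the points `θ_{k - q}`, `0 ≤ q ≤ p⁰`, differ by at most `D`,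
then `‖x(t) - y(t)‖ ≤ (K D / ζ) exp(-a (t - θ_k))` for `t ≥ θ_k`. The difference `u = x - y` solves
`u' = A(t) u + g(t)`, where the Lipschitz condition bounds `g` by the values of `u` at the delayed
nodes. With `M` the maximum of `‖u(t)‖ exp(a (t - θ_k))` over `[θ_k, T]`, the delays are at most `τ`,
so `‖g(t)‖ ≤ l m exp(a τ) max(M, D) exp(-a (t - θ_k))`, and the decay of the Cauchy matrix
(`norm_le_of_hasDerivWithinAt_linear`) gives `M ≤ K D + (1 - ζ) max(M, D)`, hence `M ≤ K D / ζ`.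
That `τ` is finite is the one consequence of the Wexler property that is needed
(`IsWexler.sub_le_delaySup`): equipotential almost periodicity bounds the gaps between nodes.

Stability is this estimate with `y = ξ`, and uniqueness for the initial value problem is the case
`D = 0`. Two almost periodic solutions have a bounded difference, so the estimate holds for them
with one `D` and every `k`; letting `k → -∞` shows that they coincide. Existence
(`exists_isSolutionFrom`) is the method of steps: on `[θ_i, θ_{i+1})` the arguments of `f` are
constants known from earlier nodes, and the variation of constants formula applies.
-/

/-! ### Node sequences -/

theorem IsNodeSequence.exists_mem_Ico {θ : ℤ → ℝ} (hθ : IsNodeSequence θ) (t : ℝ) :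
    ∃ i : ℤ, t ∈ Ico (θ i) (θ (i + 1)) := by
  obtain ⟨hmono, htop, hbot⟩ := hθ
  obtain ⟨N, hN⟩ := (htop.eventually (eventually_gt_atTop t)).exists
  obtain ⟨M, hM⟩ := (hbot.eventually (eventually_le_atBot t)).exists
  obtain ⟨i, hi, hmax⟩ := Int.exists_greatest_of_bdd (P := fun i => θ i ≤ t)
    ⟨N, fun z hz => (hmono.lt_iff_lt.mp (lt_of_le_of_lt hz hN)).le⟩ ⟨M, hM⟩
  refine ⟨i, hi, lt_of_not_ge fun h => ?_⟩
  have := hmax (i + 1) h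
  omega

theorem IsNodeSequence.beta_mem {θ : ℤ → ℝ} (hθ : IsNodeSequence θ) (t : ℝ) :
    t ∈ Ico (θ (beta θ t)) (θ (beta θ t + 1)) := by
  obtain ⟨i, hi⟩ := hθ.exists_mem_Ico t
  rwa [beta_eq_of_mem hθ.1 hi]

theorem IsNodeSequence.beta_node {θ : ℤ → ℝ} (hθ : IsNodeSequence θ) (i : ℤ) :
    beta θ (θ i) = i :=
  beta_eq_of_mem hθ.1 ⟨le_rfl, hθ.1 (by omega)⟩

theorem IsNodeSequence.mem_Ioo_beta {θ : ℤ → ℝ} (hθ : IsNodeSequence θ) {t : ℝ}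
    (ht : t ∉ range θ) : t ∈ Ioo (θ (beta θ t)) (θ (beta θ t + 1)) :=
  ⟨lt_of_le_of_ne (hθ.beta_mem t).1 fun h => ht ⟨_, h⟩, (hθ.beta_mem t).2⟩

theorem IsNodeSequence.le_beta {θ : ℤ → ℝ} (hθ : IsNodeSequence θ) {k : ℤ} {t : ℝ}
    (h : θ k ≤ t) : k ≤ beta θ t := by
  have := hθ.1.lt_iff_lt.mp (lt_of_le_of_lt h (hθ.beta_mem t).2)
  omega

/-- An almost period can be chosen so as to move any index into a fixed finite window, so the
increments of `γ` are bounded by finitely many of them, up to `1`. -/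
theorem IsEquipotentiallyAlmostPeriodic.exists_sub_le {γ : ℤ → ℝ}
    (hγ : IsEquipotentiallyAlmostPeriodic γ) : ∃ G : ℝ, ∀ i : ℤ, γ (i + 1) - γ i ≤ G := by
  obtain ⟨L, -, hL⟩ := hγ 1 one_pos
  obtain ⟨C, hC⟩ := ((finite_Icc (0 : ℤ) L).image fun i => γ (i + 1) - γ i).bddAbove
  refine ⟨C + 1, fun i => ?_⟩
  obtain ⟨q, ⟨hq1, hq2⟩, hq⟩ := hL (-i)
  have h1 := hC (mem_image_of_mem _ (show i + q ∈ Icc (0 : ℤ) L from ⟨by omega, by omega⟩))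
  have h2 := (abs_lt.mp (hq i 1)).1
  linarith

theorem IsWexler.exists_sub_le {θ : ℤ → ℝ} (hθ : IsWexler θ) :
    ∃ G : ℝ, ∀ i : ℤ, θ (i + 1) - θ i ≤ G := by
  obtain ⟨⟨hmono, -, -⟩, γ, ⟨hγmono, hrange, -⟩, hγ⟩ := hθ
  obtain ⟨G, hG⟩ := hγ.exists_sub_le
  refine ⟨G, fun i => ?_⟩
  obtain ⟨j₀, hj₀⟩ : θ i ∈ range γ := hrange ▸ mem_range_self i
  obtain ⟨j₁, hj₁⟩ : θ (i + 1) ∈ range γ := hrange ▸ mem_range_self (i + 1)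
  -- the last index at which `γ` has not yet passed `θ i`
  obtain ⟨j, hj, hmax⟩ := Int.exists_greatest_of_bdd (P := fun j => γ j ≤ θ i)
    ⟨j₁, fun z hz => by
      by_contra! h
      have h1 := hγmono h.le
      have h2 : θ i < θ (i + 1) := hmono (by omega)
      linarith⟩ ⟨j₀, hj₀.le⟩
  have hlt : θ i < γ (j + 1) := lt_of_not_ge fun h => by
    have := hmax (j + 1) h
    omega
  obtain ⟨r, hr⟩ : γ (j + 1) ∈ range θ := hrange ▸ mem_range_self (j + 1)
  rw [← hr] at hlt
  have h1 : θ (i + 1) ≤ θ r := hmono.monotone (by have := hmono.lt_iff_lt.mp hlt; omega)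
  have h2 := hG j
  linarith

theorem sub_sub_natCast_le {θ : ℤ → ℝ} {G : ℝ} (hG : ∀ i : ℤ, θ (i + 1) - θ i ≤ G) (i : ℤ)
    (q : ℕ) : θ i - θ (i - q) ≤ q * G := by
  induction q with
  | zero => simp
  | succ q ih =>
    have h := hG (i - (q + 1 : ℕ))
    rw [show i - ((q + 1 : ℕ) : ℤ) + 1 = i - q by push_cast; ring] at h
    push_cast at h ⊢
    linarith

/-- For a Wexler sequence the set of delays is bounded, so `delaySup` is a genuine supremum. -/
theorem IsWexler.sub_le_delaySup {m : ℕ} {θ : ℤ → ℝ} (hθ : IsWexler θ) (p : Fin m → ℕ) (t : ℝ)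
    (j : Fin m) : t - θ (beta θ t - (p j : ℤ)) ≤ delaySup θ p := by
  obtain ⟨G, hG⟩ := hθ.exists_sub_le
  have hG0 : 0 ≤ G := le_trans (sub_nonneg.mpr (hθ.1.1.monotone (by omega))) (hG 0)
  refine le_csSup ⟨(maxDelay p + 1) * G, ?_⟩ ⟨t, j, rfl⟩
  rintro _ ⟨s, i, rfl⟩
  have h1 := (hθ.1.beta_mem s).2
  have h2 := hG (beta θ s)
  have h3 := sub_sub_natCast_le hG (beta θ s) (p i)
  have h4 : (p i : ℝ) ≤ maxDelay p := by
    exact_mod_cast Finset.le_sup (f := p) (Finset.mem_univ i)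
  have h5 := mul_le_mul_of_nonneg_right h4 hG0
  linarith

/-! ### Solutions -/

section Solutions

variable {n m : ℕ} {A : ℝ → (Vec n →L[ℝ] Vec n)} {f : ℝ → (Fin m → Vec n) → Vec n}
  {θ : ℤ → ℝ} {p : Fin m → ℕ} {X : ℝ → (Vec n →L[ℝ] Vec n)ˣ}

theorem IsSolution.isSolutionFrom {x : ℝ → Vec n} (hx : IsSolution A f θ p x) (k : ℤ) :
    IsSolutionFrom A f θ p k x :=
  ⟨hx.1.continuousOn, fun t _ ht => hx.2.1 t ht, fun i _ => (hx.2.2 i).1,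
    fun i _ => (hx.2.2 i).2⟩

theorem IsSolutionFrom.hasDerivWithinAt {x : ℝ → Vec n} {k : ℤ} (hθ : StrictMono θ)
    (hx : IsSolutionFrom A f θ p k x) {t : ℝ} (ht : θ k ≤ t) :
    HasDerivWithinAt x (rhs A f θ p x t) (Ici t) t := by
  by_cases h : t ∈ range θ
  · obtain ⟨i, rfl⟩ := h
    exact hx.2.2.1 i (hθ.le_iff_le.mp ht)
  · exact (hx.2.1 t (lt_of_le_of_ne ht fun h' => h ⟨k, h'⟩) h).hasDerivWithinAt

theorem IsSolutionFrom.continuousOn_Ici {x : ℝ → Vec n} {k : ℤ} (hθ : StrictMono θ)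
    (hx : IsSolutionFrom A f θ p k x) : ContinuousOn x (Ici (θ k)) :=
  hx.1.mono (Ici_subset_Ici.mpr (hθ.monotone (by omega)))

/-! ### The linear equation -/

theorem IsFundamentalMatrix.hasDerivAt_inv (hX : IsFundamentalMatrix A X) (t : ℝ) :
    HasDerivAt (fun s => ((X s)⁻¹ : (Vec n →L[ℝ] Vec n)ˣ).val)
      (-(((X t)⁻¹ : (Vec n →L[ℝ] Vec n)ˣ).val * A t)) t := by
  have h := (hasFDerivAt_ringInverse (𝕜 := ℝ) (X t)).comp_hasDerivAt t (hX t)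
  have h2 : (Ring.inverse ∘ fun s => (X s : Vec n →L[ℝ] Vec n)) =
      fun s => ((X s)⁻¹ : (Vec n →L[ℝ] Vec n)ˣ).val := by
    funext s
    simp
  rw [h2] at h
  refine h.congr_deriv ?_
  simp [mul_assoc]

/-- Decay of solutions of `u' = A(t) u + g(t)` with an exponentially small inhomogeneity. The
function `s ↦ X(T, s) u(s)` has right derivative `X(T, s) g(s)`, and the mean value inequality for
right derivatives replaces the variation of constants formula, so that no regularity of `g` is
used. -/
theorem norm_le_of_hasDerivWithinAt_linear (hX : IsFundamentalMatrix A X) {K σ a c t₀ T : ℝ}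
    (hK : 0 ≤ K) (haσ : a < σ) (hc : 0 ≤ c)
    (hdich : ∀ s t : ℝ, s ≤ t → ‖cauchyMatrix X t s‖ ≤ K * Real.exp (-σ * (t - s)))
    {u g : ℝ → Vec n} (hT : t₀ ≤ T) (hu : ContinuousOn u (Icc t₀ T))
    (hderiv : ∀ s ∈ Ico t₀ T, HasDerivWithinAt u (A s (u s) + g s) (Ici s) s)
    (hg : ∀ s ∈ Ico t₀ T, ‖g s‖ ≤ c * Real.exp (-a * (s - t₀))) :
    ‖u T‖ ≤ (K * ‖u t₀‖ + K * c * (σ - a)⁻¹) * Real.exp (-a * (T - t₀)) := by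
  have hσa : 0 < σ - a := sub_pos.mpr haσ
  have hinv : ∀ s, HasDerivAt (cauchyMatrix X T) (-(cauchyMatrix X T s * A s)) s := fun s => by
    have h := (hX.hasDerivAt_inv s).const_mul (X T : Vec n →L[ℝ] Vec n)
    exact h.congr_deriv (ContinuousLinearMap.ext fun v => (X T).val.map_neg _)
  have hcont : Continuous (cauchyMatrix X T) :=
    continuous_iff_continuousAt.mpr fun s => (hinv s).continuousAt
  -- the comparison function: its derivative bounds `X(T, s) g(s)`
  set E : ℝ → ℝ := fun s => Real.exp (-σ * (T - s) - a * (s - t₀)) with hE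
  have hEd : ∀ s, HasDerivAt E ((σ - a) * E s) s := fun s => by
    have h : HasDerivAt (fun s : ℝ => -σ * (T - s) - a * (s - t₀)) (σ - a) s := by
      have h1 := (((hasDerivAt_id s).const_sub T).const_mul (-σ)).sub
        (((hasDerivAt_id s).sub_const t₀).const_mul a)
      refine h1.congr_deriv ?_
      linarith
    simpa [hE, mul_comm] using h.exp
  have hkey := image_norm_le_of_norm_deriv_right_le_deriv_boundary
    (f := fun s => cauchyMatrix X T s (u s)) (f' := fun s => cauchyMatrix X T s (g s))
    (a := t₀) (b := T)
    (B := fun s => K * Real.exp (-σ * (T - t₀)) * ‖u t₀‖ + K * c * (σ - a)⁻¹ * (E s - E t₀))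
    (B' := fun s => K * c * E s)
    (hcont.continuousOn.clm_apply hu)
    (fun s hs => by
      have h := (hinv s).hasDerivWithinAt (s := Ici s) |>.clm_apply (hderiv s hs)
      refine h.congr_deriv ?_
      simp)
    (by
      simp only [sub_self, mul_zero, add_zero]
      exact (ContinuousLinearMap.le_opNorm _ _).trans
        (mul_le_mul_of_nonneg_right (hdich t₀ T hT) (norm_nonneg _)))
    (fun s => by
      have h := (((hEd s).sub_const (E t₀)).const_mul (K * c * (σ - a)⁻¹)).const_add
        (K * Real.exp (-σ * (T - t₀)) * ‖u t₀‖)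
      refine h.congr_deriv ?_
      field_simp)
    (fun s hs => by
      refine (ContinuousLinearMap.le_opNorm _ _).trans ((mul_le_mul (hdich s T hs.2.le) (hg s hs)
        (norm_nonneg _) (by positivity)).trans_eq ?_)
      have h : E s = Real.exp (-σ * (T - s)) * Real.exp (-a * (s - t₀)) := by
        rw [← Real.exp_add, neg_mul a, ← sub_eq_add_neg]
      rw [h]
      ring)
    (right_mem_Icc.mpr hT)
  have hself : cauchyMatrix X T T = 1 := by simp [cauchyMatrix]
  simp only [hself, one_apply_eq_self] at hkey
  have h1 : E T = Real.exp (-a * (T - t₀)) := by simp [hE]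
  have h2 : 0 ≤ E t₀ := (Real.exp_pos _).le
  have h3 : Real.exp (-σ * (T - t₀)) ≤ Real.exp (-a * (T - t₀)) :=
    Real.exp_le_exp.mpr (by nlinarith)
  rw [h1] at hkey
  have h4 : K * Real.exp (-σ * (T - t₀)) * ‖u t₀‖ ≤ K * Real.exp (-a * (T - t₀)) * ‖u t₀‖ := by
    gcongr
  have h5 : 0 ≤ K * c * (σ - a)⁻¹ * E t₀ := by positivity
  linarith

/-! ### Convergence of solutions to one another -/

/-- Two solutions with the same initial moment approach each other at the rate `a`. In the weighted
norm `‖u(t)‖ exp(a (t - θ_k))` the delayed terms cost a factor `exp(a τ)`, and the weighted maximum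
`M` of the difference on `[θ_k, T]` satisfies `M ≤ K D + (1 - ζ) M` unless `M ≤ D`. -/
theorem IsSolutionFrom.norm_sub_le {l K σ a : ℝ} (hl : 0 ≤ l)
    (hlip : ∀ (t : ℝ) (z₁ z₂ : Fin m → Vec n), ‖f t z₁ - f t z₂‖ ≤ l * ∑ j, ‖z₁ j - z₂ j‖)
    (hθ : IsWexler θ) (hX : IsFundamentalMatrix A X) (hK : 1 ≤ K)
    (hdich : ∀ s t : ℝ, s ≤ t → ‖cauchyMatrix X t s‖ ≤ K * Real.exp (-σ * (t - s)))
    (ha : 0 ≤ a) (haσ : a < σ) (hζ : 0 < zeta θ p K σ a l) {k : ℤ} {x y : ℝ → Vec n}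
    (hx : IsSolutionFrom A f θ p k x) (hy : IsSolutionFrom A f θ p k y) {D : ℝ}
    (hD : ∀ q ≤ maxDelay p, ‖x (θ (k - (q : ℤ))) - y (θ (k - (q : ℤ)))‖ ≤ D)
    {T : ℝ} (hT : θ k ≤ T) :
    ‖x T - y T‖ ≤ K * D / zeta θ p K σ a l * Real.exp (-a * (T - θ k)) := by
  have hmono := hθ.1.1
  have hσa : 0 < σ - a := sub_pos.mpr haσ
  have hD₀ : ‖x (θ k) - y (θ k)‖ ≤ D := by simpa using hD 0 (Nat.zero_le _)
  have hDnn : 0 ≤ D := (norm_nonneg _).trans hD₀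
  have hζ1 : zeta θ p K σ a l ≤ 1 := by
    rw [zeta]
    have : 0 ≤ Real.exp (a * delaySup θ p) * K * l * m * (σ - a)⁻¹ := by positivity
    linarith
  set u : ℝ → Vec n := fun t => x t - y t with hu
  have hucont : ContinuousOn u (Icc (θ k) T) :=
    ((hx.continuousOn_Ici hmono).sub (hy.continuousOn_Ici hmono)).mono Icc_subset_Ici_self
  obtain ⟨s₀, hs₀, hmax⟩ := isCompact_Icc.exists_isMaxOn (nonempty_Icc.mpr hT)
    (f := fun t => ‖u t‖ * Real.exp (a * (t - θ k)))
    (hucont.norm.mul (by fun_prop))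
  set M := ‖u s₀‖ * Real.exp (a * (s₀ - θ k)) with hM
  have hexp : ∀ t, Real.exp (-a * (t - θ k)) * Real.exp (a * (t - θ k)) = 1 := fun t => by
    rw [← Real.exp_add]
    simp
  have hw : ∀ {t c : ℝ}, ‖u t‖ * Real.exp (a * (t - θ k)) ≤ c ↔
      ‖u t‖ ≤ c * Real.exp (-a * (t - θ k)) := fun {t c} => by
    have e := hexp t
    constructor <;> intro h
    · calc ‖u t‖ = ‖u t‖ * Real.exp (a * (t - θ k)) * Real.exp (-a * (t - θ k)) := by
            rw [mul_assoc, mul_comm (Real.exp (a * _)), e, mul_one]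
        _ ≤ _ := by gcongr
    · calc ‖u t‖ * Real.exp (a * (t - θ k))
          ≤ c * Real.exp (-a * (t - θ k)) * Real.exp (a * (t - θ k)) := by gcongr
        _ = c := by rw [mul_assoc, e, mul_one]
  suffices hMle : M ≤ K * D / zeta θ p K σ a l from
    hw.mp ((hmax (right_mem_Icc.mpr hT)).trans hMle)
  by_contra! hlt
  have hDM : D ≤ M := by
    refine le_trans ?_ hlt.le
    rw [le_div_iff₀ hζ]
    nlinarith
  have hM0 : 0 ≤ M := hDnn.trans hDM
  have hdelay : ∀ s ∈ Ico (θ k) s₀, ∀ j : Fin m, ‖u (θ (beta θ s - (p j : ℤ)))‖ ≤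
      M * Real.exp (a * delaySup θ p) * Real.exp (-a * (s - θ k)) := fun s hs j => by
    set i := beta θ s - (p j : ℤ) with hi
    have hβ : k ≤ beta θ s := hθ.1.le_beta hs.1
    have h1 : ‖u (θ i)‖ ≤ M * Real.exp (-a * (θ i - θ k)) := by
      rcases le_total k i with hki | hki
      · refine hw.mp (hmax ⟨hmono.monotone hki, ?_⟩)
        exact ((hmono.monotone (by omega)).trans (hθ.1.beta_mem s).1).trans
          (hs.2.le.trans hs₀.2)
      · have hq : ((k - i).toNat : ℤ) = k - i := Int.toNat_of_nonneg (by omega)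
        have hp : p j ≤ maxDelay p := Finset.le_sup (f := p) (Finset.mem_univ j)
        have h := hD (k - i).toNat (by omega)
        rw [hq, sub_sub_cancel] at h
        refine h.trans (hDM.trans (le_mul_of_one_le_right hM0 (Real.one_le_exp ?_)))
        have : θ i ≤ θ k := hmono.monotone hki
        nlinarith
    refine h1.trans ?_
    rw [mul_assoc M, ← Real.exp_add]
    refine mul_le_mul_of_nonneg_left (Real.exp_le_exp.mpr ?_) hM0
    have := mul_le_mul_of_nonneg_left (hθ.sub_le_delaySup p s j) ha
    rw [← hi] at this
    linarith
  have hstep := norm_le_of_hasDerivWithinAt_linear hX (by linarith) haσ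
    (c := l * (m * (M * Real.exp (a * delaySup θ p)))) (by positivity) hdich
    (u := u) (g := fun s => f s (fun j => x (θ (beta θ s - (p j : ℤ)))) -
      f s (fun j => y (θ (beta θ s - (p j : ℤ))))) hs₀.1
    (hucont.mono (Icc_subset_Icc_right hs₀.2))
    (fun s hs => by
      have h := (hx.hasDerivWithinAt hmono hs.1).sub (hy.hasDerivWithinAt hmono hs.1)
      refine h.congr_deriv ?_
      simp only [rhs, hu, map_sub]
      abel)
    (fun s hs => by
      refine (hlip _ _ _).trans ?_
      rw [mul_assoc]
      refine mul_le_mul_of_nonneg_left ?_ hl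
      refine (Finset.sum_le_sum fun j _ => hdelay s hs j).trans_eq ?_
      simp [mul_assoc])
  have hfin := hw.mpr hstep
  rw [← hM] at hfin
  rw [div_lt_iff₀ hζ] at hlt
  have hKD : K * ‖u (θ k)‖ ≤ K * D := mul_le_mul_of_nonneg_left hD₀ (by linarith)
  have hid : M * zeta θ p K σ a l =
      M - K * (l * (m * (M * Real.exp (a * delaySup θ p)))) * (σ - a)⁻¹ := by
    rw [zeta]
    ring
  linarith

/-! ### Existence of solutions -/

/-- Recursion along the integers `i ≥ k`, each value being determined by all earlier ones. -/
theorem exists_forall_ge_eq_of_recursion {E : Type*} (k : ℤ) (φ : ℤ → E)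
    (F : ℤ → (ℤ → E) → E)
    (hF : ∀ i v w, (∀ r ≤ i, v r = w r) → F i v = F i w) :
    ∃ v : ℤ → E, (∀ i ≤ k, v i = φ i) ∧ ∀ i, k ≤ i → v (i + 1) = F i v := by
  -- `w N` is correct up to the index `k + N`
  let w : ℕ → ℤ → E := fun N => Nat.rec φ
    (fun N w => Function.update w (k + N + 1) (F (k + N) w)) N
  have hw : ∀ N, w (N + 1) = Function.update (w N) (k + N + 1) (F (k + N) (w N)) := fun N => rfl
  have hstable : ∀ (N d : ℕ) (i : ℤ), i ≤ k + N → w (N + d) i = w N i := by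
    intro N d i hi
    induction d with
    | zero => rfl
    | succ d ih =>
      rw [← add_assoc, hw, Function.update_of_ne (by push_cast; omega), ih]
  have hval : ∀ (N : ℕ) (i : ℤ), i ≤ k + N → w (i - k).toNat i = w N i := by
    intro N i hi
    obtain ⟨d, hd⟩ := Nat.exists_eq_add_of_le (show (i - k).toNat ≤ N by omega)
    rw [hd, hstable _ _ _ (by omega)]
  refine ⟨fun i => w (i - k).toNat i, fun i hi => hval 0 i (by simpa using hi), fun i hi => ?_⟩
  obtain ⟨N, rfl⟩ : ∃ N : ℕ, i = k + N := ⟨(i - k).toNat, by omega⟩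
  rw [hF (k + N) (fun i => w (i - k).toNat i) (w N) fun r hr => hval N r hr]
  simp only
  rw [hval (N + 1) (k + N + 1) (by push_cast; omega), hw, Function.update_self]

/-- Continuous pieces over the intervals `[θ_i, θ_{i+1}]` that agree at the nodes glue to a
continuous function. -/
theorem IsNodeSequence.exists_continuous_eqOn {E : Type*} [TopologicalSpace E]
    (hθ : IsNodeSequence θ) (g : ℤ → ℝ → E) (hg : ∀ i, Continuous (g i))
    (hglue : ∀ i, g i (θ (i + 1)) = g (i + 1) (θ (i + 1))) :
    ∃ x : ℝ → E, Continuous x ∧ ∀ i, EqOn x (g i) (Icc (θ i) (θ (i + 1))) := by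
  have hx : ∀ i, EqOn (fun t => g (beta θ t) t) (g i) (Icc (θ i) (θ (i + 1))) := by
    intro i t ht
    rcases ht.2.lt_or_eq with h | rfl
    · simp only [beta_eq_of_mem hθ.1 ⟨ht.1, h⟩]
    · simp only [hθ.beta_node, hglue]
  refine ⟨_, ?_, hx⟩
  refine continuous_iff_continuousAt.mpr fun t => ?_
  obtain ⟨i, hi⟩ := hθ.exists_mem_Ico t
  have hc : ∀ i, t ∈ Icc (θ i) (θ (i + 1)) →
      ContinuousWithinAt (fun t => g (beta θ t) t) (Icc (θ i) (θ (i + 1))) t := fun i hi =>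
    (hg i).continuousWithinAt.congr (hx i) (hx i hi)
  rcases hi.1.eq_or_lt with rfl | h
  · have h1 : θ (i - 1) < θ i := hθ.1 (by omega)
    have hl := hc (i - 1) (by rw [sub_add_cancel]; exact ⟨h1.le, le_rfl⟩)
    rw [sub_add_cancel] at hl
    exact continuousAt_iff_continuous_left_right.mpr
      ⟨hl.mono_of_mem_nhdsWithin (Icc_mem_nhdsLE h1),
        (hc i ⟨le_rfl, hi.2.le⟩).mono_of_mem_nhdsWithin (Icc_mem_nhdsGE hi.2)⟩
  · exact (hc i ⟨h.le, hi.2.le⟩).continuousAt (Icc_mem_nhds h hi.2)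

theorem continuous_apply_of_isAlmostPeriodicOn (hf : ∀ s : ℝ, 0 ≤ s → IsAlmostPeriodicOn f s)
    (z : Fin m → Vec n) : Continuous fun t => f t z := by
  have hz : z ∈ ballProd n m ‖z‖ := fun j => norm_le_pi_norm z j
  exact (hf ‖z‖ (norm_nonneg z)).2.1.continuousOn.comp_continuous
    (f := fun t : ℝ => (t, z)) (by fun_prop) fun t => ⟨mem_univ _, hz⟩

/-- The variation of constants formula for `y' = A(t) y + h(t)`, `y(t₀) = v`. -/
noncomputable def variationOfConstants (X : ℝ → (Vec n →L[ℝ] Vec n)ˣ) (h : ℝ → Vec n) (t₀ : ℝ)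
    (v : Vec n) (t : ℝ) : Vec n :=
  (X t).val (((X t₀)⁻¹ : (Vec n →L[ℝ] Vec n)ˣ).val v +
    ∫ s in t₀..t, ((X s)⁻¹ : (Vec n →L[ℝ] Vec n)ˣ).val (h s))

theorem variationOfConstants_self (h : ℝ → Vec n) (t₀ : ℝ) (v : Vec n) :
    variationOfConstants X h t₀ v t₀ = v := by
  rw [variationOfConstants, intervalIntegral.integral_same, add_zero,
    ← mul_apply_eq_comp, Units.mul_inv, one_apply_eq_self]

theorem IsFundamentalMatrix.hasDerivAt_variationOfConstants (hX : IsFundamentalMatrix A X)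
    {h : ℝ → Vec n} (hh : Continuous h) (t₀ : ℝ) (v : Vec n) (t : ℝ) :
    HasDerivAt (variationOfConstants X h t₀ v)
      (A t (variationOfConstants X h t₀ v t) + h t) t := by
  have hc : Continuous fun s => ((X s)⁻¹ : (Vec n →L[ℝ] Vec n)ˣ).val (h s) :=
    (continuous_iff_continuousAt.mpr fun s => (hX.hasDerivAt_inv s).continuousAt).clm_apply hh
  have h1 := (hc.integral_hasStrictDerivAt t₀ t).hasDerivAt.const_add
    (((X t₀)⁻¹ : (Vec n →L[ℝ] Vec n)ˣ).val v)
  have h2 := (hX t).clm_apply h1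
  refine h2.congr_deriv ?_
  have h3 : (X t).val (((X t)⁻¹ : (Vec n →L[ℝ] Vec n)ˣ).val (h t)) = h t := by
    rw [← mul_apply_eq_comp, Units.mul_inv, one_apply_eq_self]
  rw [h3]
  rfl

/-- The initial value problem is solved interval by interval: once the values at the nodes up to
`θ_i` are known, the equation on `[θ_i, θ_{i+1})` is linear with a known inhomogeneity. -/
theorem exists_isSolutionFrom (hf : ∀ s : ℝ, 0 ≤ s → IsAlmostPeriodicOn f s)
    (hθ : IsNodeSequence θ) (hX : IsFundamentalMatrix A X) (k : ℤ) (φ : ℕ → Vec n) :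
    ∃ x : ℝ → Vec n, IsSolutionFrom A f θ p k x ∧
      ∀ q : ℕ, x (θ (k - (q : ℤ))) = φ q := by
  let S : ℤ → (ℤ → Vec n) → ℝ → Vec n := fun i v =>
    variationOfConstants X (fun t => f t fun j => v (i - (p j : ℤ))) (θ i) (v i)
  obtain ⟨v, hvφ, hvS⟩ := exists_forall_ge_eq_of_recursion k (fun i => φ (k - i).toNat)
    (fun i v => S i v (θ (i + 1))) (fun i v w hvw => by
      have h1 : (fun j => v (i - (p j : ℤ))) = fun j => w (i - (p j : ℤ)) :=
        funext fun j => hvw _ (by omega)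
      simp only [S, h1, hvw i le_rfl])
  have hS : ∀ i t, HasDerivAt (S i v) (A t (S i v t) + f t fun j => v (i - (p j : ℤ))) t :=
    fun i t => hX.hasDerivAt_variationOfConstants
      (continuous_apply_of_isAlmostPeriodicOn hf _) _ _ _
  -- to the left of `θ k` any continuous interpolation of the initial values will do
  let g : ℤ → ℝ → Vec n := fun i => if k ≤ i then S i v else fun t =>
    AffineMap.lineMap (v i) (v (i + 1)) ((t - θ i) / (θ (i + 1) - θ i))
  have hg_of_le : ∀ {i}, k ≤ i → g i = S i v := fun h => if_pos h
  have hgc : ∀ i, Continuous (g i) := fun i => by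
    by_cases hi : k ≤ i
    · rw [hg_of_le hi]
      exact continuous_iff_continuousAt.mpr fun t => (hS i t).continuousAt
    · simp only [g, if_neg hi, AffineMap.lineMap_apply]
      fun_prop
  have hgl : ∀ i, g i (θ i) = v i := fun i => by
    by_cases hi : k ≤ i
    · rw [hg_of_le hi]
      exact variationOfConstants_self _ _ _
    · simp [g, if_neg hi]
  have hgr : ∀ i, g i (θ (i + 1)) = v (i + 1) := fun i => by
    by_cases hi : k ≤ i
    · rw [hg_of_le hi, hvS i hi]
    · have h : θ (i + 1) - θ i ≠ 0 := sub_ne_zero.mpr (hθ.1 (by omega)).ne'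
      simp [g, if_neg hi, div_self h]
  obtain ⟨x, hxc, hxg⟩ := hθ.exists_continuous_eqOn g hgc fun i => by rw [hgr, hgl]
  have hlt : ∀ i, θ i < θ (i + 1) := fun i => hθ.1 (by omega)
  have hxθ : ∀ i, x (θ i) = v i := fun i => by
    rw [hxg i ⟨le_rfl, (hlt i).le⟩, hgl]
  have hrhs : ∀ i, k ≤ i → ∀ t ∈ Ico (θ i) (θ (i + 1)),
      rhs A f θ p x t = A t (S i v t) + f t fun j => v (i - (p j : ℤ)) := fun i hi t ht => by
    rw [rhs, beta_eq_of_mem hθ.1 ht, hxg i ⟨ht.1, ht.2.le⟩, hg_of_le hi]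
    simp only [hxθ]
  have hxS : ∀ i, k ≤ i → EqOn x (S i v) (Icc (θ i) (θ (i + 1))) := fun i hi =>
    hg_of_le hi ▸ hxg i
  refine ⟨x, ⟨hxc.continuousOn, fun t hkt ht => ?_, fun i hi => ?_, fun i hi => ?_⟩, fun q => ?_⟩
  · have hi := hθ.le_beta hkt.le
    rw [hrhs _ hi t (hθ.beta_mem t)]
    refine (hS _ t).congr_of_eventuallyEq ?_
    have hmem := hθ.mem_Ioo_beta ht
    exact (hxS _ hi).eventuallyEq_of_mem (Icc_mem_nhds hmem.1 hmem.2)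
  · rw [hrhs i hi _ ⟨le_rfl, hlt i⟩]
    exact (hS i _).hasDerivWithinAt.congr_of_eventuallyEq
      ((hxS i hi).eventuallyEq_of_mem (Icc_mem_nhdsGE (hlt i))) (hxS i hi ⟨le_rfl, (hlt i).le⟩)
  · obtain ⟨i, rfl⟩ : ∃ r, i = r + 1 := ⟨i - 1, by omega⟩
    exact ⟨_, (hS i _).hasDerivWithinAt.congr_of_eventuallyEq
      ((hxS i (by omega)).eventuallyEq_of_mem (Icc_mem_nhdsLE (hlt i)))
      (hxS i (by omega) ⟨(hlt i).le, le_rfl⟩)⟩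
  · rw [hxθ, hvφ _ (by omega)]
    congr 1
    omega

end Solutions

/-! ### Exponential stability -/

theorem mainTheorem2 {n m : ℕ} (hm : 1 ≤ m)
    (A : ℝ → (Vec n →L[ℝ] Vec n)) (f : ℝ → (Fin m → Vec n) → Vec n)
    (θ : ℤ → ℝ) (p : Fin m → ℕ) (X : ℝ → (Vec n →L[ℝ] Vec n)ˣ) (l K σ a : ℝ)
    (hC1 : IsAlmostPeriodic A)
    (hC2 : ∀ s : ℝ, 0 ≤ s → IsAlmostPeriodicOn f s)
    (hl : 0 < l)
    (hC3 : ∀ (t : ℝ) (z₁ z₂ : Fin m → Vec n), ‖f t z₁ - f t z₂‖ ≤ l * ∑ j, ‖z₁ j - z₂ j‖)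
    (hC5 : IsWexler θ)
    (hX : IsFundamentalMatrix A X) (hK : 1 ≤ K) (hσ : 0 < σ)
    (hC6 : ∀ s t : ℝ, s ≤ t → ‖cauchyMatrix X t s‖ ≤ K * Real.exp (-σ * (t - s)))
    (hC7 : l < σ / (m * K))
    (ha : 0 < a) (haσ : a < σ)
    (hC8 : 0 < zeta θ p K σ a l)
    (ξ : ℝ → Vec n) (hξ : IsAlmostPeriodic ξ) (hξsol : IsSolution A f θ p ξ) :
    (∀ ξ' : ℝ → Vec n, IsAlmostPeriodic ξ' → IsSolution A f θ p ξ' → ξ' = ξ) ∧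
    ∀ k : ℤ,
      (∀ φ : ℕ → Vec n,
        (∃ x : ℝ → Vec n, IsSolutionFrom A f θ p k x ∧
          ∀ q ≤ maxDelay p, x (θ (k - (q : ℤ))) = φ q) ∧
        ∀ x y : ℝ → Vec n, IsSolutionFrom A f θ p k x → IsSolutionFrom A f θ p k y →
          (∀ q ≤ maxDelay p, x (θ (k - (q : ℤ))) = φ q) →
          (∀ q ≤ maxDelay p, y (θ (k - (q : ℤ))) = φ q) →
          EqOn x y (Ici (θ k))) ∧
      IsExponentiallyStable A f θ p (Iic (maxDelay p)) k a ξ ∧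
      ((∀ q ≤ maxDelay p, ∃ j, p j = q) → IsExponentiallyStable A f θ p (range p) k a ξ) := by
  have hest : ∀ {k : ℤ} {x y : ℝ → Vec n}, IsSolutionFrom A f θ p k x →
      IsSolutionFrom A f θ p k y → ∀ {D : ℝ},
      (∀ q ≤ maxDelay p, ‖x (θ (k - (q : ℤ))) - y (θ (k - (q : ℤ)))‖ ≤ D) → ∀ {T : ℝ}, θ k ≤ T →
      ‖x T - y T‖ ≤ K * D / zeta θ p K σ a l * Real.exp (-a * (T - θ k)) :=
    fun hx hy _ hD _ hT =>
      hx.norm_sub_le hl.le hC3 hC5 hX hK hC6 ha.le haσ hC8 hy hD hT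
  have hstable : ∀ k, IsExponentiallyStable A f θ p (Iic (maxDelay p)) k a ξ := by
    refine fun k => ⟨ha, fun ε hε => ?_⟩
    have hK0 : 0 < K := by linarith
    -- half of the radius `ε ζ / K`, for the inequality to be strict
    refine ⟨ε * zeta θ p K σ a l / (2 * K), by positivity, fun x hx hinit t ht => ?_⟩
    refine (hest hx (hξsol.isSolutionFrom k) (fun q hq => (hinit q hq).le) ht).trans_lt ?_
    refine mul_lt_mul_of_pos_right ?_ (Real.exp_pos _)
    have : K * (ε * zeta θ p K σ a l / (2 * K)) / zeta θ p K σ a l = ε / 2 := by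
      field_simp
    linarith
  refine ⟨fun ξ' hξ' hξ'sol => ?_, fun k => ⟨fun φ => ⟨?_, ?_⟩, hstable k, fun hp => ?_⟩⟩
  · obtain ⟨⟨C, hC⟩, -⟩ := hξ
    obtain ⟨⟨C', hC'⟩, -⟩ := hξ'
    funext t
    -- the difference is bounded, so the initial moment can be sent to `-∞`
    have hbound : ∀ᶠ k : ℤ in atBot, ‖ξ' t - ξ t‖ ≤
        K * (C' + C) / zeta θ p K σ a l * Real.exp (-a * (t - θ k)) := by
      filter_upwards [hC5.1.2.2.eventually (eventually_le_atBot t)] with k hk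
      exact hest (hξ'sol.isSolutionFrom k) (hξsol.isSolutionFrom k)
        (fun q _ => (norm_sub_le _ _).trans (add_le_add (hC' _) (hC _))) hk
    have hlim : Tendsto (fun k : ℤ => K * (C' + C) / zeta θ p K σ a l *
        Real.exp (-a * (t - θ k))) atBot (𝓝 0) := by
      have h1 : Tendsto (fun k : ℤ => -a * (t - θ k)) atBot atBot := by
        have h2 := (tendsto_atBot_add_const_left atBot (-t) hC5.1.2.2).const_mul_atBot ha
        refine h2.congr fun k => ?_
        linarith
      simpa using (Real.tendsto_exp_atBot.comp h1).const_mul (K * (C' + C) / zeta θ p K σ a l)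
    exact sub_eq_zero.mp (norm_le_zero_iff.mp (ge_of_tendsto hlim hbound))
  · obtain ⟨x, hx, hxφ⟩ := exists_isSolutionFrom (p := p) hC2 hC5.1 hX k φ
    exact ⟨x, hx, fun q _ => hxφ q⟩
  · intro x y hx hy hxφ hyφ t ht
    have h := hest hx hy (D := 0) (fun q hq => by rw [hxφ q hq, hyφ q hq, sub_self, norm_zero]) ht
    simp only [mul_zero, zero_div, zero_mul] at h
    exact sub_eq_zero.mp (norm_le_zero_iff.mp h)
  · refine ⟨ha, fun ε hε => ?_⟩
    obtain ⟨δ, hδ, h⟩ := (hstable k).2 ε hε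
    refine ⟨δ, hδ, fun x hx hinit => h x hx fun q hq => hinit q ?_⟩
    exact hp q hq
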